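/- Let $X$ be a compact Hausdorff space, $f\colon X\to X$ a continuous map, and $m\ge 1$ an integer. An *$m$-shift system* for $f$ is a family $\mathcal H=(I_1,\dots,I_m)$ of nonempty subsets of $X$ (not necessarily disjoint) such that $f(I_i)\supseteq I_1\cup\dots\cup I_m$ for every $i$. Its *kernel* is $\bigcup_{i\ne j}I_i\cap I_j$, its *center* is $C=\bigcap_{i=1}^m I_i$, and its *core* is $Z_0=\{x\in X: f^k(x)\in C\text{ for all }k\ge 0\}$. The system is *closed* if every $I_i$ is closed, and *nontrivial* if $I_i\setminus Z_0\neq\emptyset$ for every $i$. The kernel is *eventually countable* if its image under $f^j$ is at most countable for some $j\ge 0$. A *minimal set* of $f$ is a nonempty closed set $M\subseteq X$ with $f(M)\subseteq M$ that contains no smaller such set. Let $\Sigma_m=\{1,\dots,m\}^{\{0,1,2,\dots\}}$ be the one-sided full shift with shift map $\sigma$. A set $W\subseteq X$ *locally divides* $\mathcal H$ if 1. $f(W)\subseteq W$; 2. $I_i\setminus W\ne\emptyset$ for $i=1,\dots,m$; 3. there are a closed set $\Lambda\subseteq\Sigma_m$ with $\sigma(\Lambda)\subseteq\Lambda$ whose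 topological entropy satisfies $h(\sigma|_\Lambda)<\log m$, and a neighborhood $V$ of $W$ in $X$, such that for all $x\in X$ and $n\ge 1$ with $f^i(x)\in V\setminus W$ for $i=0,\dots,n-1$, every word $a_0\cdots a_{n-1}$ in $\{1,\dots,m\}$ with $f^i(x)\in I_{a_i}$ for all $0\le i<n$ is the initial word of length $n$ of some sequence in $\Lambda$. (Here $h=-\infty$ for the map of the empty set.) **Theorem.** Suppose $f$ has a closed, nontrivial $m$-shift system $\mathcal H$ whose kernel is eventually countable, and suppose there is a set $W\subseteq X$ that contains every minimal set of $f$ contained in the core $Z_0$ and that locally divides $\mathcal H$. Then the topological entropy of $f$ satisfies $h(f)\ge\log m$. -/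

import Mathlib

/-- An `m`-shift system for `f : X → X`: a family of `m` nonempty sets, the image of each of which
contains the union of all of them. -/
structure ShiftSystem {X : Type*} (f : X → X) (m : ℕ) where
  /-- The sets `I₁, …, I_m` of the system. -/
  piece : Fin m → Set X
  nonempty : ∀ i, (piece i).Nonempty
  covers : ∀ i, (⋃ j, piece j) ⊆ f '' piece i

namespace ShiftSystem

variable {X : Type*} {f : X → X} {m : ℕ}

/-- The kernel: the points that lie in at least two of the sets of the system. -/
def kernel (H : ShiftSystem f m) : Set X :=
  {x | ∃ i j, i ≠ j ∧ x ∈ H.piece i ∩ H.piece j}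

/-- The center: the points that lie in all `m` sets of the system. -/
def center (H : ShiftSystem f m) : Set X :=
  ⋂ i, H.piece i

/-- The core: the points whose whole forward orbit lies in the center. -/
def core (H : ShiftSystem f m) : Set X :=
  {x | ∀ k : ℕ, f^[k] x ∈ H.center}

/-- No set of the system is contained in the core. -/
def IsNontrivial (H : ShiftSystem f m) : Prop :=
  ∀ i, (H.piece i \ H.core).Nonempty

/-- All sets of the system are closed. -/
def IsClosedSystem [TopologicalSpace X] (H : ShiftSystem f m) : Prop :=
  ∀ i, IsClosed (H.piece i)

/-- Some forward image of the kernel is (at most) countable. -/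
def KernelEventuallyCountable (H : ShiftSystem f m) : Prop :=
  ∃ j : ℕ, (f^[j] '' H.kernel).Countable

/-- The `n`-itinerary set of `x`: the words `a₀ … aₙ₋₁` with `fⁱ x ∈ I_{aᵢ}` for all `i < n`. -/
def itineraries (H : ShiftSystem f m) (x : X) (n : ℕ) : Set (Fin n → Fin m) :=
  {a | ∀ i : Fin n, f^[(i : ℕ)] x ∈ H.piece (a i)}

end ShiftSystem

/-- The one-sided shift `(σ a) n = a (n + 1)` on sequences of symbols in `{1, …, m}`. -/
def oneSidedShift (m : ℕ) : (ℕ → Fin m) → (ℕ → Fin m) :=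
  fun a n => a (n + 1)

/-- The set of initial words of length `n` of the sequences in `L`. -/
def initialWords {m : ℕ} (L : Set (ℕ → Fin m)) (n : ℕ) : Set (Fin n → Fin m) :=
  (fun (a : ℕ → Fin m) (i : Fin n) => a i) '' L

/-- The topological entropy of the one-sided shift restricted to `L`; the sequence space carries
the product of the discrete uniform structures. -/
noncomputable def shiftEntropy {m : ℕ} (L : Set (ℕ → Fin m)) : EReal :=
  letI : UniformSpace (Fin m) := ⊥
  Dynamics.coverEntropy (oneSidedShift m) L

/-- A minimal set of `f`: minimal among the nonempty closed forward-invariant sets. -/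
def IsMinimalSet {X : Type*} [TopologicalSpace X] (f : X → X) (M : Set X) : Prop :=
  Minimal (fun S : Set X => S.Nonempty ∧ IsClosed S ∧ Set.MapsTo f S S) M

/-- The set `W` locally divides the shift system `H`. -/
structure LocallyDivides {X : Type*} [TopologicalSpace X] {f : X → X} {m : ℕ}
    (W : Set X) (H : ShiftSystem f m) : Prop where
  image_subset : f '' W ⊆ W
  not_subset : ∀ i, (H.piece i \ W).Nonempty
  exists_small_shift : ∃ L : Set (ℕ → Fin m),
    IsClosed L ∧ Set.MapsTo (oneSidedShift m) L L ∧
    shiftEntropy L < ((Real.log m : ℝ) : EReal) ∧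
    ∃ V : Set X, W ⊆ interior V ∧
      ∀ (x : X) (n : ℕ), 0 < n → (∀ i < n, f^[i] x ∈ V \ W) →
        H.itineraries x n ⊆ initialWords L n

/-!
Suppose that `h(f) < a < log m`. Going backwards from a point of some `I i` outside `W`, every word
over `{1, …, m}` is followed by some point, and the orbit segment in question avoids `W`, since `W`
is forward invariant. Averaging over all words of length `n` and all times gives empirical measures;
let `μ` be a regular invariant limit of them as `n → ∞`. The `m ^ n` words are counted again through
the orbits following them, and this count turns out to be too small.

The image `Q` of the kernel under `f^[j]` is compact and countable, so `μ` charges it only at atoms,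
which are periodic points by Poincaré recurrence (`mem_periodicPts_of_measure_singleton_ne_zero`).
Words followed outside `W` near a periodic point `p` have growth rate less than `log m`: if `p` is
not in the core, some symbol is forbidden once per period (`exists_words_of_notMem_core`); if `p` is
in the core, its orbit is a minimal set, hence lies in `W`, and local division applies
(`exists_words_of_mem_core`). Away from finitely many periodic points `P₀`, orbits visit a small
neighbourhood of `Q` rarely, so a word is nearly determined by a dynamical cover of `X`, which has
growth rate less than `a`. So every word has a code made of blocks of these two types.

The count is a Kraft inequality (`sum_exp_neg_birkhoffSum_le`): if a continuous function `φ` pays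
for all blocks, then `∑ exp (-∑ φ)` over the words of length `n` is bounded, whence
`log m ≤ ∫ φ dμ` by convexity. The growth rates near `P₀` may approach `log m` as `P₀` grows, so the
gain is not taken from all of `P₀`: a finite set `P₁` carrying all but mass `1/2` of the atoms fixes
the gain `g` first, and `P₀` is chosen afterwards, for an error that is small compared to `g`. Near
`P₀ \ P₁` words are copied verbatim, which costs no more than `log m` per symbol, and happens at
most half of the time. Then `∫ φ dμ < log m`, a contradiction.
-/

open MeasureTheory Filter Topology Function Dynamics
open scoped ENNReal Uniformity

/-! ### Limits of empirical measures -/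

/-- The empirical measures of finite families of points of a compact Hausdorff space converge, along
some ultrafilter, to a regular probability measure. -/
lemma exists_tendsto_average_integral {X : Type*} [TopologicalSpace X] [CompactSpace X]
    [T2Space X] [MeasurableSpace X] [BorelSpace X] {ι : ℕ → Type*} [∀ n, Fintype (ι n)]
    [∀ n, Nonempty (ι n)] (g : ∀ n, ι n → X) :
    ∃ (F : Ultrafilter ℕ) (μ : Measure X), (F : Filter ℕ) ≤ atTop ∧ μ.Regular ∧
      IsProbabilityMeasure μ ∧ ∀ u : C(X, ℝ),
        Tendsto (fun n => (Fintype.card (ι n) : ℝ)⁻¹ * ∑ i, u (g n i)) F (𝓝 (∫ x, u x ∂μ)) := by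
  have hP : ∀ n, ∃ P : ProbabilityMeasure X, ∀ u : C(X, ℝ),
      ∫ x, u x ∂(P : Measure X) = (Fintype.card (ι n) : ℝ)⁻¹ * ∑ i, u (g n i) := by
    intro n
    refine ⟨⟨(Fintype.card (ι n) : ℝ≥0∞)⁻¹ • ∑ i, Measure.dirac (g n i), ⟨?_⟩⟩, fun u => ?_⟩
    · simp only [Measure.smul_apply, Measure.coe_finsetSum, Finset.sum_apply, measure_univ,
        Finset.sum_const, Finset.card_univ, nsmul_eq_mul, mul_one, smul_eq_mul]
      exact ENNReal.inv_mul_cancel (by simp) (by simp)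
    · have hu : ∀ i ∈ Finset.univ, Integrable (fun x => u x) (Measure.dirac (g n i)) := fun i _ =>
        u.continuous.integrable_of_hasCompactSupport (HasCompactSupport.of_compactSpace _)
      simp only [ProbabilityMeasure.coe_mk]
      rw [integral_smul_measure, integral_finsetSum_measure hu]
      simp
  choose P hP using hP
  let F : Ultrafilter ℕ := hyperfilter ℕ
  obtain ⟨μ₀, -, hμ₀⟩ := isCompact_univ.ultrafilter_le_nhds (F.map P) (by simp)
  obtain ⟨μ, hreg, hfin, hμ⟩ := Measure.exists_regular_eq_of_compactSpace (μ₀ : Measure X)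
  refine ⟨F, μ, Nat.hyperfilter_le_atTop, hreg, ⟨?_⟩, fun u => ?_⟩
  · have := hμ 1
    simp only [BoundedContinuousFunction.coe_one, Pi.one_apply, integral_const, probReal_univ,
      smul_eq_mul, mul_one] at this
    rw [← ENNReal.toReal_eq_one_iff]
    exact this.symm
  · have h := (ProbabilityMeasure.tendsto_iff_forall_integral_tendsto (μs := P) (F := (F : Filter ℕ))
      (μ := μ₀)).1 hμ₀ (BoundedContinuousFunction.mkOfCompact u)
    rw [hμ] at h
    simpa only [BoundedContinuousFunction.mkOfCompact_apply, hP] using h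

section Invariant

variable {X : Type*} [TopologicalSpace X] [T2Space X] [MeasurableSpace X] [BorelSpace X] {f : X → X} {μ : Measure X}

lemma measurePreserving_of_integral_comp_eq [CompactSpace X] [IsFiniteMeasure μ] [μ.Regular] (hf : Continuous f)
    (h : ∀ u : C(X, ℝ), ∫ x, u (f x) ∂μ = ∫ x, u x ∂μ) : MeasurePreserving f μ μ := by
  refine ⟨hf.measurable, ?_⟩
  have := Measure.InnerRegularCompactLTTop.map_of_continuous (μ := μ) hf
  refine Measure.ext_of_integral_eq_on_compactlySupported fun u => ?_
  exact (integral_map hf.aemeasurable u.continuous.aestronglyMeasurable).trans (h u)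

/-- Poincaré recurrence for a single point. -/
lemma mem_periodicPts_of_measure_singleton_ne_zero [IsFiniteMeasure μ]
    (hf : MeasurePreserving f μ μ) {x : X} (hx : μ {x} ≠ 0) : x ∈ periodicPts f := by
  obtain ⟨y, hy, n, hn, hn'⟩ := hf.conservative.exists_mem_iterate_mem
    (MeasurableSet.singleton x).nullMeasurableSet hx
  rw [Set.mem_singleton_iff] at hy
  subst hy
  exact ⟨n, Nat.pos_of_ne_zero hn, hn'⟩

/-- A closed set of measure less than `r` has an open neighbourhood whose indicator function is
dominated by a continuous function of integral less than `r`. -/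
lemma exists_continuousMap_one_le_of_measure_lt [CompactSpace X] [IsFiniteMeasure μ] [μ.Regular]
    {C : Set X} (hC : IsClosed C) {r : ℝ} (hr : μ C < ENNReal.ofReal r) :
    ∃ (u : C(X, ℝ)) (O : Set X), (∀ x, 0 ≤ u x) ∧ IsOpen O ∧ C ⊆ O ∧ (∀ x ∈ O, 1 ≤ u x) ∧
      ∫ x, u x ∂μ < r := by
  obtain ⟨O₁, hCO₁, hO₁, hμO₁⟩ := C.exists_isOpen_lt_of_lt _ hr
  obtain ⟨O, hO, hCO, hOO₁⟩ := normal_exists_closure_subset hC hO₁ hCO₁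
  obtain ⟨u, hu0, hu1, hu⟩ := exists_continuous_zero_one_of_isClosed hO₁.isClosed_compl
    (isClosed_closure (s := O)) (Set.disjoint_compl_left_iff_subset.2 hOO₁)
  refine ⟨u, O, fun x => (hu x).1, hO, hCO, fun x hx => (hu1 (subset_closure hx)).ge, ?_⟩
  have hint : ∫ x, u x ∂μ ≤ ∫ x, O₁.indicator 1 x ∂μ := by
    refine integral_mono
      (u.continuous.integrable_of_hasCompactSupport (HasCompactSupport.of_compactSpace _))
      ((integrable_const (1 : ℝ)).indicator hO₁.measurableSet) fun x => ?_
    by_cases hx : x ∈ O₁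
    · simpa [hx] using (hu x).2
    · simpa [hx] using (hu0 hx).le
  rw [integral_indicator_one hO₁.measurableSet] at hint
  refine hint.trans_lt ?_
  rw [measureReal_def, ← ENNReal.lt_ofReal_iff_toReal_lt (measure_ne_top μ _)]
  exact hμO₁

/-- All but an arbitrarily small amount of the atomic part of a finite invariant measure sits on a
finite forward invariant set of atoms. -/
lemma exists_finite_mapsTo_measure_atoms_diff_lt [IsFiniteMeasure μ] (hf : MeasurePreserving f μ μ)
    {δ : ℝ≥0∞} (hδ : δ ≠ 0) :
    ∃ F : Set X, F.Finite ∧ F ⊆ {x | μ {x} ≠ 0} ∧ Set.MapsTo f F F ∧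
      μ ({x | μ {x} ≠ 0} \ F) < δ := by
  set A : Set X := {x | μ {x} ≠ 0} with hA
  have hAc : A.Countable := by
    simpa [pos_iff_ne_zero] using Measure.countable_meas_pos_of_disjoint_iUnion (μ := μ)
      (As := fun x : X => {x}) (fun x => measurableSet_singleton x)
      (fun x y hxy => Set.disjoint_singleton.2 hxy)
  have hAf : ∀ x ∈ A, f x ∈ A := by
    intro x hx h0
    refine hx (measure_mono_null ?_ ((hf.measure_preimage
      (measurableSet_singleton (f x)).nullMeasurableSet).trans h0))
    rintro y rfl
    rfl
  have hAit : ∀ x ∈ A, ∀ k, f^[k] x ∈ A := fun x hx k =>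
    (show Set.MapsTo f A A from hAf).iterate k hx
  have hsum : ∑' x : A, μ {(x : X)} ≠ ∞ := by
    have := hAc.to_subtype
    rw [← measure_biUnion hAc (fun x _ y _ hxy => Set.disjoint_singleton.2 hxy)
      (fun x _ => measurableSet_singleton x)]
    exact measure_ne_top _ _
  obtain ⟨s, hs⟩ := ((ENNReal.tendsto_tsum_compl_atTop_zero hsum).eventually_lt_const
    (pos_iff_ne_zero.2 hδ)).exists
  let s' : Set X := Subtype.val '' (s : Set A)
  have hs'fin : s'.Finite := s.finite_toSet.image _
  have hs'A : s' ⊆ A := by rintro _ ⟨x, -, rfl⟩; exact x.2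
  -- close the finite set up under `f`: the orbits of atoms are finite
  refine ⟨⋃ x ∈ s', (fun k => f^[k] x) '' Set.Iio (minimalPeriod f x), ?_, ?_, ?_, ?_⟩
  · exact hs'fin.biUnion fun x _ => (Set.finite_Iio _).image _
  · intro y hy
    simp only [Set.mem_iUnion] at hy
    obtain ⟨x, hx, k, -, rfl⟩ := hy
    exact hAit x (hs'A hx) k
  · intro y hy
    simp only [Set.mem_iUnion] at hy ⊢
    obtain ⟨x, hx, k, -, rfl⟩ := hy
    have hp := mem_periodicPts_of_measure_singleton_ne_zero hf (hs'A hx)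
    refine ⟨x, hx, (k + 1) % minimalPeriod f x,
      Nat.mod_lt _ (minimalPeriod_pos_of_mem_periodicPts hp), ?_⟩
    simp only [iterate_mod_minimalPeriod_eq, iterate_succ_apply']
  · refine lt_of_le_of_lt ?_ hs
    have hsub : A \ (⋃ x ∈ s', (fun k => f^[k] x) '' Set.Iio (minimalPeriod f x)) ⊆
        ⋃ x : {x : A // x ∉ s}, {((x : A) : X)} := by
      rintro y ⟨hyA, hy⟩
      refine Set.mem_iUnion.2 ⟨⟨⟨y, hyA⟩, fun hys => hy ?_⟩, rfl⟩
      have hp := mem_periodicPts_of_measure_singleton_ne_zero hf hyA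
      exact Set.mem_biUnion ⟨⟨y, hyA⟩, hys, rfl⟩
        ⟨0, minimalPeriod_pos_of_mem_periodicPts hp, rfl⟩
    have := hAc.to_subtype
    exact (measure_mono hsub).trans (measure_iUnion_le _)

end Invariant

/-! ### A Kraft inequality along orbits -/

lemma card_le_pow_of_forall_length_eq {α : Type*} [Fintype α] {n : ℕ} {S : Finset (List α)}
    (hS : ∀ l ∈ S, l.length = n) : S.card ≤ Fintype.card α ^ n := by
  classical
  have : S ⊆ Finset.univ.image fun v : Fin n → α => List.ofFn v := by
    intro l hl
    obtain rfl := hS l hl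
    exact Finset.mem_image.2 ⟨l.get, Finset.mem_univ _, List.ofFn_get l⟩
  calc S.card ≤ _ := Finset.card_le_card this
    _ ≤ _ := Finset.card_image_le
    _ = _ := by simp

/-- A Kraft inequality: `adm x l` says that the word `l` is admissible for the point `x`. If every
long admissible word has a prefix in a finite family of code words whose weights have sum at most
`1`, and the weight of this prefix dominates `exp (-∑ φ)` along the corresponding orbit segment of
`x`, then `exp (-∑ φ)` has bounded sum over any set of words of length `n`. -/
lemma sum_exp_neg_birkhoffSum_le {X α ι : Type*} [Fintype α] [Nonempty α] [Fintype ι] {f : X → X}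
    {adm : X → List α → Prop} (hadm : ∀ x w l, adm x (w ++ l) → adm (f^[w.length] x) l)
    {φ : X → ℝ} (hφ : ∀ x, 0 ≤ φ x) (w : ι → List α) (ω : ι → ℝ) (hω : ∀ k, 0 ≤ ω k)
    (hsum : ∑ k, ω k ≤ 1) {D : ℕ} (hpos : ∀ k, 0 < (w k).length)
    (hcode : ∀ x l, adm x l → D ≤ l.length →
      ∃ k, w k <+: l ∧ Real.exp (-birkhoffSum f φ (w k).length x) ≤ ω k)
    (n : ℕ) (S : Finset (List α)) (hS : ∀ l ∈ S, l.length = n) (x : List α → X)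
    (hx : ∀ l ∈ S, adm (x l) l) :
    ∑ l ∈ S, Real.exp (-birkhoffSum f φ n (x l)) ≤ (Fintype.card α : ℝ) ^ D := by
  classical
  induction n using Nat.strong_induction_on generalizing S x with
  | _ n ih =>
  have hcard : (1 : ℝ) ≤ Fintype.card α := by exact_mod_cast Fintype.card_pos
  rcases lt_or_ge n D with hn | hn
  · calc ∑ l ∈ S, Real.exp (-birkhoffSum f φ n (x l)) ≤ ∑ l ∈ S, 1 := by
          refine Finset.sum_le_sum fun l _ => Real.exp_le_one_iff.2 ?_
          rw [neg_nonpos]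
          exact Finset.sum_nonneg fun i _ => hφ _
      _ = S.card := by simp
      _ ≤ (Fintype.card α : ℝ) ^ n := by exact_mod_cast card_le_pow_of_forall_length_eq hS
      _ ≤ _ := pow_le_pow_right₀ hcard hn.le
  rcases S.eq_empty_or_nonempty with rfl | ⟨l₀, hl₀⟩
  · simp
  have hk : ∀ l ∈ S, ∃ k, w k <+: l ∧ Real.exp (-birkhoffSum f φ (w k).length (x l)) ≤ ω k :=
    fun l hl => hcode (x l) l (hx l hl) (hn.trans (hS l hl).ge)
  have : Nonempty ι := ⟨(hk l₀ hl₀).choose⟩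
  choose! c hc using hk
  calc ∑ l ∈ S, Real.exp (-birkhoffSum f φ n (x l))
      = ∑ k, ∑ l ∈ S with c l = k, Real.exp (-birkhoffSum f φ n (x l)) :=
        (Finset.sum_fiberwise S c _).symm
    _ ≤ ∑ k, ω k * (Fintype.card α : ℝ) ^ D := Finset.sum_le_sum fun k _ => ?_
    _ = (∑ k, ω k) * (Fintype.card α : ℝ) ^ D := (Finset.sum_mul ..).symm
    _ ≤ _ := mul_le_of_le_one_left (by positivity) hsum
  -- remove the common prefix `w k` from the words with code `k`
  set Sk := {l ∈ S | c l = k} with hSk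
  have happ : ∀ l ∈ Sk, w k ++ l.drop (w k).length = l := by
    intro l hl
    obtain ⟨hlS, rfl⟩ := Finset.mem_filter.1 hl
    exact (List.prefix_iff_eq_append.1 (hc l hlS).1)
  have hinj : Set.InjOn (List.drop (w k).length) (Sk : Set (List α)) := by
    intro l hl l' hl' h
    rw [← happ l hl, ← happ l' hl', h]
  have hstep : ∀ l ∈ Sk, Real.exp (-birkhoffSum f φ n (x l)) ≤
      ω k * Real.exp (-birkhoffSum f φ (n - (w k).length)
        (f^[(w k).length] (x (w k ++ l.drop (w k).length)))) := by
    intro l hl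
    have h := happ l hl
    obtain ⟨hlS, rfl⟩ := Finset.mem_filter.1 hl
    have hle : (w (c l)).length ≤ n := (hS l hlS) ▸ (hc l hlS).1.length_le
    rw [h]
    have : birkhoffSum f φ n (x l) = birkhoffSum f φ (w (c l)).length (x l) +
        birkhoffSum f φ (n - (w (c l)).length) (f^[(w (c l)).length] (x l)) := by
      rw [← birkhoffSum_add, Nat.add_sub_cancel' hle]
    rw [this, neg_add, Real.exp_add]
    exact mul_le_mul_of_nonneg_right (hc l hlS).2 (Real.exp_pos _).le
  refine (Finset.sum_le_sum hstep).trans ?_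
  rw [← Finset.mul_sum]
  refine mul_le_mul_of_nonneg_left ?_ (hω k)
  rw [← Finset.sum_image (f := fun l' => Real.exp (-birkhoffSum f φ (n - (w k).length)
        (f^[(w k).length] (x (w k ++ l'))))) hinj]
  rcases Sk.eq_empty_or_nonempty with h0 | ⟨l₁, hl₁⟩
  · simp [h0]
  have hle : (w k).length ≤ n := by
    obtain ⟨hlS, rfl⟩ := Finset.mem_filter.1 hl₁
    exact (hS l₁ hlS) ▸ (hc l₁ hlS).1.length_le
  refine ih (n - (w k).length) (by have := hpos k; omega) _ ?_ _ ?_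
  · intro l' hl'
    obtain ⟨l, hl, rfl⟩ := Finset.mem_image.1 hl'
    rw [List.length_drop, hS l (Finset.mem_filter.1 hl).1]
  · intro l' hl'
    obtain ⟨l, hl, rfl⟩ := Finset.mem_image.1 hl'
    refine hadm _ _ _ ?_
    rw [happ l hl]
    exact hx l (Finset.mem_filter.1 hl).1

/-! ### Exponential bounds from topological entropy -/

/-- A strict upper bound on the topological entropy bounds the size of dynamical covers. -/
lemma eventually_exists_isDynCoverOf_card_le {X : Type*} [UniformSpace X] {T : X → X} {F : Set X}
    {c : ℝ} (hc : coverEntropy T F < c) {U : SetRel X X} (hU : U ∈ 𝓤 X) :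
    ∀ᶠ n : ℕ in atTop, ∃ s : Finset X, IsDynCoverOf T F U n s ∧ (s.card : ℝ) ≤ Real.exp (c * n) := by
  have h : ExpGrowth.expGrowthSup (fun n : ℕ => (coverMincard T F U n : ENNReal)) < c :=
    (coverEntropyEntourage_le_coverEntropy T F hU).trans_lt hc
  filter_upwards [ExpGrowth.eventually_le_exp h] with n hn
  have hexp : EReal.exp ((c : EReal) * n) = ENNReal.ofReal (Real.exp (c * n)) := by
    rw [← EReal.exp_coe]
    norm_cast
  rw [hexp] at hn
  have hlt : coverMincard T F U n < ⊤ := by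
    have := hn.trans_lt ENNReal.ofReal_lt_top
    exact_mod_cast this
  obtain ⟨s, hs, hcard⟩ := (coverMincard_finite_iff T F U n).1 hlt
  refine ⟨s, hs, ?_⟩
  rw [← hcard] at hn
  have : ENNReal.ofReal (s.card : ℝ) ≤ ENNReal.ofReal (Real.exp (c * n)) := by
    simpa using hn
  exact (ENNReal.ofReal_le_ofReal_iff (Real.exp_pos _).le).1 this

lemma eventually_ncard_initialWords_le {m : ℕ} {L : Set (ℕ → Fin m)} {c : ℝ}
    (hc : shiftEntropy L < c) :
    ∀ᶠ n : ℕ in atTop, ((initialWords L n).ncard : ℝ) ≤ Real.exp (c * n) := by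
  let _ : UniformSpace (Fin m) := ⊥
  let U : SetRel (ℕ → Fin m) (ℕ → Fin m) := {p | p.1 0 = p.2 0}
  have hU : U ∈ 𝓤 (ℕ → Fin m) := by
    have h : (SetRel.id : SetRel (Fin m) (Fin m)) ∈ 𝓤 (Fin m) := by
      rw [bot_uniformity]; exact mem_principal_self _
    exact (Pi.uniformContinuous_proj (fun _ : ℕ => Fin m) 0) h
  filter_upwards [eventually_exists_isDynCoverOf_card_le hc hU] with n hn
  obtain ⟨s, hs, hcard⟩ := hn
  refine le_trans ?_ hcard
  classical
  have hsub : initialWords L n ⊆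
      (s.image fun (a : ℕ → Fin m) (i : Fin n) => a i : Finset (Fin n → Fin m)) := by
    rintro _ ⟨a, ha, rfl⟩
    obtain ⟨b, hb, hab⟩ := hs ha
    refine Finset.mem_coe.2 (Finset.mem_image.2 ⟨b, hb, ?_⟩)
    have hit : ∀ (k : ℕ) (a : ℕ → Fin m) (i : ℕ), (oneSidedShift m)^[k] a i = a (i + k) := by
      intro k
      induction k with
      | zero => intro a i; rfl
      | succ k ih => intro a i; rw [iterate_succ_apply, ih]; simp [oneSidedShift, add_assoc]
    funext i
    have := mem_dynEntourage.1 hab i i.2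
    simpa [U, hit] using this.symm
  have := Set.ncard_le_ncard hsub (Finset.finite_toSet _)
  rw [Set.ncard_coe_finset] at this
  exact_mod_cast this.trans Finset.card_image_le

/-! ### Words read off near a periodic orbit -/

/-- The orbit of a periodic point is a minimal set. -/
lemma isMinimalSet_range_iterate {X : Type*} [TopologicalSpace X] [T1Space X] {f : X → X} {p : X}
    (hp : p ∈ periodicPts f) : IsMinimalSet f (Set.range fun k => f^[k] p) := by
  have hpos := minimalPeriod_pos_of_mem_periodicPts hp
  have hfin : (Set.range fun k => f^[k] p).Finite := by
    refine ((Set.finite_Iio (minimalPeriod f p)).image fun k => f^[k] p).subset ?_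
    rintro _ ⟨k, rfl⟩
    exact ⟨k % minimalPeriod f p, Nat.mod_lt _ hpos, iterate_mod_minimalPeriod_eq⟩
  refine ⟨⟨⟨p, 0, rfl⟩, hfin.isClosed, ?_⟩, ?_⟩
  · rintro _ ⟨k, rfl⟩
    exact ⟨k + 1, iterate_succ_apply' f k p⟩
  · rintro S ⟨⟨y, hy⟩, -, hS⟩ hSsub _ ⟨k, rfl⟩
    obtain ⟨l, rfl⟩ := hSsub hy
    -- the point `f^[l] p` returns to `p` after `minimalPeriod f p * l - l` steps
    have h := hS.iterate (k + (minimalPeriod f p * l - l)) hy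
    have hle : l ≤ minimalPeriod f p * l := Nat.le_mul_of_pos_left l hpos
    rw [← iterate_add_apply, add_assoc, Nat.sub_add_cancel hle, iterate_add_apply,
      ((isPeriodicPt_minimalPeriod f p).mul_const l).eq] at h
    exact h

namespace ShiftSystem

variable {X : Type*} {f : X → X} {m : ℕ}

/-- The point `x` follows the word `l` through the sets of `H`, and its orbit stays outside `W`
during this time. -/
def Follows (H : ShiftSystem f m) (W : Set X) (x : X) (l : List (Fin m)) : Prop :=
  (∀ (i : ℕ) (hi : i < l.length), f^[i] x ∈ H.piece l[i]) ∧ ∀ i < l.length, f^[i] x ∉ W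

lemma Follows.of_append {H : ShiftSystem f m} {W : Set X} {x : X} {w l : List (Fin m)}
    (h : H.Follows W x (w ++ l)) : H.Follows W (f^[w.length] x) l := by
  refine ⟨fun i hi => ?_, fun i hi => ?_⟩
  · have := h.1 (i + w.length) (by simp; omega)
    rw [iterate_add_apply] at this
    simpa using this
  · have := h.2 (i + w.length) (by simp; omega)
    rwa [iterate_add_apply] at this

lemma Follows.of_prefix {H : ShiftSystem f m} {W : Set X} {x : X} {w l : List (Fin m)}
    (h : H.Follows W x l) (hw : w <+: l) : H.Follows W x w := by
  refine ⟨fun i hi => ?_, fun i hi => h.2 i (hi.trans_le hw.length_le)⟩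
  have := h.1 i (hi.trans_le hw.length_le)
  rwa [← hw.getElem hi] at this

/-- Every word can be followed outside `W`: take preimages of `y`, all of which avoid the forward
invariant set `W`. -/
lemma exists_follows (H : ShiftSystem f m) {W : Set X} (hW : f '' W ⊆ W) {y : X}
    (hy : y ∈ ⋃ i, H.piece i) (hyW : y ∉ W) (l : List (Fin m)) : ∃ x, H.Follows W x l := by
  suffices h : ∃ x ∈ ⋃ i, H.piece i, x ∉ W ∧ H.Follows W x l by
    obtain ⟨x, -, -, hx⟩ := h; exact ⟨x, hx⟩
  induction l with
  | nil => exact ⟨y, hy, hyW, by simp [Follows]⟩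
  | cons a l ih =>
    obtain ⟨x', hx', hx'W, hfol⟩ := ih
    obtain ⟨x, hx, rfl⟩ := H.covers a hx'
    have hxW : x ∉ W := fun h => hx'W (hW ⟨x, h, rfl⟩)
    refine ⟨x, Set.mem_iUnion.2 ⟨a, hx⟩, hxW, fun i hi => ?_, fun i hi => ?_⟩
    · cases i with
      | zero => simpa using hx
      | succ i => simpa using hfol.1 i (by simpa using hi)
    · cases i with
      | zero => simpa using hxW
      | succ i => simpa using hfol.2 i (by simpa using hi)

/-- The words of length `R` followed near a periodic point outside the core have exponential growth
rate less than `log m`: once per period, a symbol is forbidden. -/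
lemma exists_words_of_notMem_core [TopologicalSpace X] (hf : Continuous f) (hm : 2 ≤ m)
    (H : ShiftSystem f m) (hH : H.IsClosedSystem) {p : X} (hp : p ∈ periodicPts f)
    (hpc : p ∉ H.core) (W : Set X) :
    ∃ c < Real.log m, ∀ᶠ R : ℕ in atTop, ∃ (G : Set X) (B : Finset (List (Fin m))), IsOpen G ∧
      p ∈ G ∧ (∀ l ∈ B, l.length = R) ∧ (B.card : ℝ) ≤ Real.exp (c * R) ∧
      ∀ x ∈ G, ∀ l, l.length = R → H.Follows W x l → l ∈ B := by
  classical
  obtain ⟨k, hk⟩ : ∃ k, f^[k] p ∉ H.center := by simpa [core] using hpc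
  set d := minimalPeriod f p with hd
  have hdpos : 0 < d := minimalPeriod_pos_of_mem_periodicPts hp
  have hdR : (0 : ℝ) < d := by exact_mod_cast hdpos
  have hk₀ : k % d < d := Nat.mod_lt _ hdpos
  have hm' : (1 : ℝ) ≤ (m : ℝ) - 1 := by
    have : (2 : ℝ) ≤ m := by exact_mod_cast hm
    linarith
  set e := Real.log m - Real.log ((m : ℝ) - 1) with he
  have hepos : 0 < e := sub_pos.2 (Real.log_lt_log (by linarith) (by linarith))
  refine ⟨Real.log m - e / (2 * d), by linarith [div_pos hepos (by positivity : (0:ℝ) < 2 * d)], ?_⟩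
  filter_upwards [eventually_ge_atTop (2 * d)] with R hR
  let allowed : ℕ → Finset (Fin m) := fun i => {b | f^[i] p ∈ H.piece b}
  refine ⟨⋂ i ∈ Finset.range R, ⋂ b ∈ (Finset.univ.filter fun b => f^[i] p ∉ H.piece b),
      f^[i] ⁻¹' (H.piece b)ᶜ,
    (Fintype.piFinset fun i : Fin R => allowed i).image List.ofFn, ?_, ?_, ?_, ?_, ?_⟩
  · exact isOpen_biInter_finset fun i _ => isOpen_biInter_finset fun b _ =>
      (hH b).isOpen_compl.preimage (hf.iterate i)
  · simp
  · intro l hl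
    obtain ⟨v, -, rfl⟩ := Finset.mem_image.1 hl
    simp
  · -- the times congruent to `k` modulo `d`
    let J : Finset ℕ := (Finset.range (R / d)).image fun q => k % d + d * q
    have hJR : J ⊆ Finset.range R := by
      intro i hi
      obtain ⟨q, hq, rfl⟩ := Finset.mem_image.1 hi
      rw [Finset.mem_range] at hq ⊢
      calc k % d + d * q < d + d * q := by omega
        _ = d * (q + 1) := by ring
        _ ≤ d * (R / d) := Nat.mul_le_mul_left _ hq
        _ ≤ R := Nat.mul_div_le R d
    have hJcard : J.card = R / d := by
      rw [Finset.card_image_of_injective, Finset.card_range]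
      intro q q' h
      exact Nat.eq_of_mul_eq_mul_left hdpos (Nat.add_left_cancel h)
    have hJ : ∀ i ∈ J, ((allowed i).card : ℝ) ≤ Real.exp (Real.log m - e) := by
      intro i hi
      obtain ⟨q, -, rfl⟩ := Finset.mem_image.1 hi
      have hit : f^[k % d + d * q] p = f^[k] p := by
        rw [← iterate_mod_minimalPeriod_eq (n := k % d + d * q), ← hd, Nat.add_mul_mod_self_left,
          Nat.mod_mod, iterate_mod_minimalPeriod_eq]
      have hlt : (allowed (k % d + d * q)).card < m := by
        have : allowed (k % d + d * q) ≠ Finset.univ := by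
          intro h
          refine hk (Set.mem_iInter.2 fun b => ?_)
          have : b ∈ allowed (k % d + d * q) := h ▸ Finset.mem_univ b
          simpa [allowed, hit] using this
        simpa using (Finset.card_lt_iff_ne_univ _).2 this
      rw [he, sub_sub_cancel, Real.exp_log (by linarith)]
      have : ((allowed (k % d + d * q)).card : ℝ) + 1 ≤ m := by exact_mod_cast hlt
      linarith
    have hall : ∀ i, ((allowed i).card : ℝ) ≤ Real.exp (Real.log m) := by
      intro i
      rw [Real.exp_log (by linarith)]
      have := Finset.card_le_univ (allowed i)
      rw [Fintype.card_fin] at this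
      exact_mod_cast this
    have hRd : (R : ℝ) / d - 1 ≤ ((R / d : ℕ) : ℝ) := by
      have := Nat.lt_div_mul_add (a := R) hdpos
      rw [sub_le_iff_le_add, div_le_iff₀ hdR]
      have : (R : ℝ) < (R / d : ℕ) * d + d := by exact_mod_cast this
      linarith
    calc ((((Fintype.piFinset fun i : Fin R => allowed i).image List.ofFn).card : ℕ) : ℝ)
        ≤ ((Fintype.piFinset fun i : Fin R => allowed i).card : ℕ) := by
          exact_mod_cast Finset.card_image_le
      _ = ∏ i ∈ Finset.range R, ((allowed i).card : ℝ) := by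
          rw [Fintype.card_piFinset, Nat.cast_prod]
          exact Fin.prod_univ_eq_prod_range (fun i => ((allowed i).card : ℝ)) R
      _ ≤ ∏ i ∈ Finset.range R, Real.exp (Real.log m - if i ∈ J then e else 0) := by
          refine Finset.prod_le_prod (fun _ _ => Nat.cast_nonneg _) fun i _ => ?_
          split_ifs with hi
          · exact hJ i hi
          · simpa using hall i
      _ = Real.exp (R * Real.log m - (R / d : ℕ) * e) := by
          rw [← Real.exp_sum, Finset.sum_sub_distrib, Finset.sum_ite_mem,
            Finset.inter_eq_right.2 hJR]
          simp [hJcard]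
      _ ≤ _ := by
          rw [Real.exp_le_exp]
          have h2 : (2 : ℝ) * d ≤ R := by exact_mod_cast hR
          have h3 : (1 : ℝ) ≤ R / (2 * d) := by rw [le_div_iff₀ (by positivity)]; linarith
          have h4 : (R : ℝ) / d = 2 * (R / (2 * d)) := by field_simp
          have h5 : e / (2 * d) * R = e * (R / (2 * d)) := by ring
          have h6 : R / (2 * d) ≤ ((R / d : ℕ) : ℝ) := by linarith
          nlinarith [mul_le_mul_of_nonneg_left h6 hepos.le]
  · intro x hx l hl hfol
    subst hl
    refine Finset.mem_image.2 ⟨l.get, Fintype.mem_piFinset.2 fun i => ?_, List.ofFn_get l⟩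
    by_contra hcon
    simp only [Set.mem_iInter] at hx
    exact hx i (Finset.mem_range.2 i.2) (l.get i) (by simpa [allowed] using hcon)
      (hfol.1 i i.2)

/-- The words of length `R` followed outside `W` near a periodic point of the core have exponential
growth rate less than `log m`: this is what local division provides. -/
lemma exists_words_of_mem_core [TopologicalSpace X] [T1Space X] (hf : Continuous f)
    {H : ShiftSystem f m} {W : Set X} (hWdiv : LocallyDivides W H)
    (hWmin : ∀ M : Set X, IsMinimalSet f M → M ⊆ H.core → M ⊆ W) {p : X} (hp : p ∈ periodicPts f)
    (hpc : p ∈ H.core) :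
    ∃ c < Real.log m, ∀ᶠ R : ℕ in atTop, ∃ (G : Set X) (B : Finset (List (Fin m))), IsOpen G ∧
      p ∈ G ∧ (∀ l ∈ B, l.length = R) ∧ (B.card : ℝ) ≤ Real.exp (c * R) ∧
      ∀ x ∈ G, ∀ l, l.length = R → H.Follows W x l → l ∈ B := by
  classical
  obtain ⟨L, -, -, hL, V, hWV, hV⟩ := hWdiv.exists_small_shift
  obtain ⟨c, hc, hcm⟩ := EReal.lt_iff_exists_real_btwn.1 hL
  have horb : (Set.range fun k => f^[k] p) ⊆ W := by
    refine hWmin _ (isMinimalSet_range_iterate hp) ?_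
    rintro _ ⟨k, rfl⟩ i
    rw [← iterate_add_apply]
    exact hpc _
  refine ⟨c, by exact_mod_cast hcm, ?_⟩
  filter_upwards [eventually_ncard_initialWords_le hc, eventually_gt_atTop 0] with R hR hRpos
  refine ⟨⋂ i ∈ Finset.range R, f^[i] ⁻¹' interior V,
    (Set.toFinite (initialWords L R)).toFinset.image List.ofFn, ?_, ?_, ?_, ?_, ?_⟩
  · exact isOpen_biInter_finset fun i _ => isOpen_interior.preimage (hf.iterate i)
  · simp only [Set.mem_iInter]
    exact fun i _ => hWV (horb ⟨i, rfl⟩)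
  · intro l hl
    obtain ⟨v, -, rfl⟩ := Finset.mem_image.1 hl
    simp
  · refine le_trans ?_ hR
    rw [Set.ncard_eq_toFinset_card _ (Set.toFinite _)]
    exact_mod_cast Finset.card_image_le
  · intro x hx l hl hfol
    subst hl
    simp only [Set.mem_iInter, Finset.mem_range] at hx
    refine Finset.mem_image.2 ⟨l.get, ?_, List.ofFn_get l⟩
    rw [Set.Finite.mem_toFinset]
    exact hV x l.length hRpos (fun i hi => ⟨interior_subset (hx i hi), hfol.2 i hi⟩)
      (fun i => hfol.1 i i.2)

end ShiftSystem

/-! ### Coding words along orbits -/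

namespace ShiftSystem

variable {X : Type*} {f : X → X} {m : ℕ}

/-- The sum of `exp (-∑ φ)` over the words of length `n` is bounded, provided that `φ` pays for the
following code of a followed word. Far from the points of `P`, encode a block of length `T` by an
element of the cover `s`, which determines all symbols except those read off in `N`; near
`p ∈ P`, encode at most `T - 1` symbols verbatim and the next `R` symbols by an element of `B p`. -/
lemma sum_exp_neg_birkhoffSum_le_of_blocks (H : ShiftSystem f m) (hm : 0 < m) {W : Set X} {φ : X → ℝ}
    (hφ : ∀ x, 0 ≤ φ x) {T R : ℕ} (hT : 0 < T) (hR : 0 < R)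
    (P : Finset X) (G : X → Set X) (B : X → Finset (List (Fin m))) (c : X → ℝ)
    (hBlen : ∀ p ∈ P, ∀ l ∈ B p, l.length = R)
    (hBcard : ∀ p ∈ P, ((B p).card : ℝ) ≤ Real.exp (c p * R))
    (hBmem : ∀ p ∈ P, ∀ x ∈ G p, ∀ l, l.length = R → H.Follows W x l → l ∈ B p)
    (s : Finset X) {a : ℝ} (hs : (s.card : ℝ) ≤ Real.exp (a * T)) (symb : X → Fin m) (N : Set X)
    (hcov : ∀ x, ∃ z ∈ s, ∀ i < T, ∀ b, f^[i] x ∈ H.piece b → f^[i] x ∉ N → b = symb (f^[i] z))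
    {κ K : ℝ} (hκK : Real.exp (-κ) + m * Real.exp (-K) ≤ 1) (hκ : 0 ≤ κ) (hK : 0 ≤ K)
    (hfar : ∀ x, (∀ i < T, ∀ p ∈ P, f^[i] x ∉ G p) →
      Real.log 2 + a * T + (κ * T + K * birkhoffSum f (N.indicator 1) T x) ≤ birkhoffSum f φ T x)
    (hnear : ∀ x, ∀ t < T, ∀ p ∈ P, f^[t] x ∈ G p →
      Real.log (2 * T * P.card) + t * Real.log m + c p * R ≤ birkhoffSum f φ (t + R) x)
    (n : ℕ) (S : Finset (List (Fin m))) (hS : ∀ l ∈ S, l.length = n) (x : List (Fin m) → X)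
    (hx : ∀ l ∈ S, H.Follows W (x l) l) :
    ∑ l ∈ S, Real.exp (-birkhoffSum f φ n (x l)) ≤ (m : ℝ) ^ (T + R) := by
  classical
  have : Nonempty (Fin m) := ⟨⟨0, hm⟩⟩
  have hmR : (0 : ℝ) < m := by exact_mod_cast hm
  let q : Fin m → Fin m → ℝ := fun b b' => if b = b' then Real.exp (-κ) else Real.exp (-K)
  have hq0 : ∀ b b', 0 ≤ q b b' := fun b b' => by
    dsimp only [q]; split_ifs <;> exact (Real.exp_pos _).le
  have hq1 : ∀ b', ∑ b, q b b' ≤ 1 := by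
    intro b'
    refine le_trans ?_ hκK
    calc ∑ b, q b b' ≤ ∑ b, ((if b = b' then Real.exp (-κ) else 0) + Real.exp (-K)) := by
          refine Finset.sum_le_sum fun b _ => ?_
          dsimp only [q]
          split_ifs
          · linarith [Real.exp_pos (-K)]
          · simp
      _ = _ := by simp [Finset.sum_add_distrib]
  let ι := (↥s × (Fin T → Fin m)) ⊕ ((Σ t : Fin T, Fin t → Fin m) × (Σ p : ↥P, ↥(B p)))
  let w : ι → List (Fin m) := Sum.elim (fun k => List.ofFn k.2)
    (fun k => List.ofFn k.1.2 ++ (k.2.2 : List (Fin m)))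
  let ω : ι → ℝ := Sum.elim
    (fun k => Real.exp (-(Real.log 2 + a * T)) * ∏ i, q (k.2 i) (symb (f^[i] k.1)))
    (fun k => Real.exp (-Real.log (2 * T * P.card)) *
      (Real.exp (-(k.1.1 * Real.log m)) * Real.exp (-(c k.2.1 * R))))
  have hω : ∀ k, 0 ≤ ω k := by
    rintro (k | k)
    · exact mul_nonneg (Real.exp_pos _).le (Finset.prod_nonneg fun i _ => hq0 _ _)
    · dsimp only [ω, Sum.elim_inr]; positivity
  have hsumA : ∑ k : ↥s × (Fin T → Fin m), ω (Sum.inl k) ≤ 1 / 2 := by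
    rw [Fintype.sum_prod_type]
    calc ∑ z : ↥s, ∑ v : Fin T → Fin m, ω (Sum.inl (z, v))
        = ∑ z : ↥s, Real.exp (-(Real.log 2 + a * T)) *
            ∏ i : Fin T, ∑ b, q b (symb (f^[i] z)) := by
          refine Finset.sum_congr rfl fun z _ => ?_
          rw [Finset.prod_univ_sum, Fintype.piFinset_univ, Finset.mul_sum]
          rfl
      _ ≤ ∑ z : ↥s, Real.exp (-(Real.log 2 + a * T)) * 1 := by
          refine Finset.sum_le_sum fun z _ => mul_le_mul_of_nonneg_left ?_ (Real.exp_pos _).le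
          exact Finset.prod_le_one (fun i _ => Finset.sum_nonneg fun b _ => hq0 _ _)
            fun i _ => hq1 _
      _ = s.card * Real.exp (-(a * T)) * (1 / 2) := by
          rw [neg_add, Real.exp_add, Real.exp_neg (Real.log 2), Real.exp_log two_pos]
          simp
          ring
      _ ≤ Real.exp (a * T) * Real.exp (-(a * T)) * (1 / 2) := by gcongr
      _ = 1 / 2 := by rw [← Real.exp_add]; simp
  have hsumB : ∑ k : (Σ t : Fin T, Fin t → Fin m) × (Σ p : ↥P, ↥(B p)), ω (Sum.inr k) ≤ 1 / 2 := by
    have h1 : ∑ k : Σ t : Fin T, Fin t → Fin m, Real.exp (-(k.1 * Real.log m)) = T := by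
      rw [Fintype.sum_sigma]
      have : ∀ t : Fin T, ∑ _u : Fin t → Fin m, Real.exp (-((t : ℕ) * Real.log m)) = 1 := by
        intro t
        rw [Finset.sum_const, Finset.card_univ, Fintype.card_fun, Fintype.card_fin,
          Fintype.card_fin, Real.exp_neg, Real.exp_nat_mul, Real.exp_log hmR]
        simp [hmR.ne']
      simp [this]
    have h2 : ∑ k : Σ p : ↥P, ↥(B p), Real.exp (-(c k.1 * R)) ≤ P.card := by
      rw [Fintype.sum_sigma]
      calc ∑ p : ↥P, ∑ _b : ↥(B p), Real.exp (-(c p * R)) ≤ ∑ _p : ↥P, (1 : ℝ) := by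
            refine Finset.sum_le_sum fun p _ => ?_
            rw [Finset.sum_const, Finset.card_univ, Fintype.card_coe, nsmul_eq_mul]
            calc _ ≤ Real.exp (c p * R) * Real.exp (-(c p * R)) := by
                  gcongr; exact hBcard p p.2
              _ = 1 := by rw [← Real.exp_add]; simp
        _ = P.card := by simp
    rw [Fintype.sum_prod_type]
    calc _ = Real.exp (-Real.log (2 * T * P.card)) *
          ((∑ k : Σ t : Fin T, Fin t → Fin m, Real.exp (-(k.1 * Real.log m))) *
            ∑ k : Σ p : ↥P, ↥(B p), Real.exp (-(c k.1 * R))) := by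
          rw [Finset.sum_mul_sum, Finset.mul_sum]
          refine Finset.sum_congr rfl fun k _ => ?_
          rw [Finset.mul_sum]
          rfl
      _ ≤ Real.exp (-Real.log (2 * T * P.card)) * (T * P.card) := by rw [h1]; gcongr
      _ ≤ 1 / 2 := by
          rcases P.card.eq_zero_or_pos with h0 | hpos
          · simp [h0]
          · have hTR : (0 : ℝ) < T := by exact_mod_cast hT
            have hPR : (0 : ℝ) < P.card := by exact_mod_cast hpos
            rw [Real.exp_neg, Real.exp_log (by positivity)]
            field_simp
            rfl
  have hsum : ∑ k, ω k ≤ 1 := by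
    rw [Fintype.sum_sum_type]; linarith
  have hpos : ∀ k, 0 < (w k).length := by
    rintro (k | k)
    · simpa [w] using hT
    · have := hBlen k.2.1 k.2.1.2 k.2.2 k.2.2.2
      simp only [w, Sum.elim_inr, List.length_append, this]
      omega
  have key := sum_exp_neg_birkhoffSum_le (f := f) (adm := H.Follows W)
    (fun _ _ _ h => h.of_append) hφ w ω hω hsum (D := T + R) hpos ?_ n S hS x hx
  · simpa using key
  intro x l hfol hlen
  by_cases hcase : ∃ t < T, ∃ p ∈ P, f^[t] x ∈ G p
  · obtain ⟨t, ht, p, hp, hxp⟩ := hcase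
    have hpre : l.take (t + R) <+: l := List.take_prefix _ _
    have hsplit : l.take (t + R) = l.take t ++ (l.drop t).take R := List.take_add
    have htl : (l.take t).length = t := by rw [List.length_take]; omega
    have hbl : ((l.drop t).take R).length = R := by
      rw [List.length_take, List.length_drop]; omega
    have hb : (l.drop t).take R ∈ B p := by
      refine hBmem p hp _ hxp _ hbl ?_
      have := (hfol.of_prefix hpre)
      rw [hsplit] at this
      simpa [htl] using this.of_append
    have hu : List.ofFn (fun i : Fin t => l[(i : ℕ)]'(by omega)) = l.take t := by
      refine List.ext_getElem (by simp; omega) fun i h₁ h₂ => by simp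
    refine ⟨Sum.inr (⟨⟨t, ht⟩, fun i => l[(i : ℕ)]'(by have := i.2; simp at this; omega)⟩,
      ⟨⟨p, hp⟩, ⟨_, hb⟩⟩), ?_, ?_⟩
    · change List.ofFn (fun i : Fin t => l[(i : ℕ)]'(by omega)) ++ (l.drop t).take R <+: l
      rw [hu, ← hsplit]
      exact hpre
    · have hwl : (w (Sum.inr (⟨⟨t, ht⟩, fun i => l[(i : ℕ)]'(by have := i.2; simp at this; omega)⟩,
          ⟨⟨p, hp⟩, ⟨_, hb⟩⟩))).length = t + R := by
        simp [w]
        omega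
      rw [hwl]
      dsimp only [ω, Sum.elim_inr]
      rw [← Real.exp_add, ← Real.exp_add, Real.exp_le_exp]
      linarith [hnear x t ht p hp hxp]
  · push Not at hcase
    obtain ⟨z, hz, hzx⟩ := hcov x
    have hTl : T ≤ l.length := by omega
    let v : Fin T → Fin m := fun i => l[(i : ℕ)]'(by omega)
    have hv : List.ofFn v = l.take T :=
      List.ext_getElem (by simp; omega) fun i h₁ h₂ => by simp [v]
    refine ⟨Sum.inl (⟨z, hz⟩, v), ?_, ?_⟩
    · change List.ofFn v <+: l
      rw [hv]
      exact List.take_prefix _ _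
    · have hwl : (w (Sum.inl (⟨z, hz⟩, v))).length = T := by simp [w]
      rw [hwl]
      dsimp only [ω, Sum.elim_inl]
      have hprod : Real.exp (-(κ * T + K * birkhoffSum f (N.indicator 1) T x)) ≤
          ∏ i : Fin T, q (v i) (symb (f^[i] z)) := by
        have : -(κ * T + K * birkhoffSum f (N.indicator 1) T x) =
            ∑ i : Fin T, -(κ + K * N.indicator 1 (f^[i] x)) := by
          rw [Fin.sum_univ_eq_sum_range (fun i => -(κ + K * N.indicator 1 (f^[i] x))) T,
            Finset.sum_neg_distrib, Finset.sum_add_distrib, ← Finset.mul_sum]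
          simp [birkhoffSum, mul_comm]
        rw [this, Real.exp_sum]
        refine Finset.prod_le_prod (fun _ _ => (Real.exp_pos _).le) fun i _ => ?_
        by_cases hN : f^[i] x ∈ N
        · dsimp only [q]
          rw [Set.indicator_of_mem hN, Pi.one_apply]
          split_ifs <;> rw [Real.exp_le_exp] <;> linarith
        · have : v i = symb (f^[i] z) := hzx i i.2 _ (hfol.1 i _) hN
          simp [q, this, hN]
      calc _ ≤ Real.exp (-(Real.log 2 + a * T)) *
            Real.exp (-(κ * T + K * birkhoffSum f (N.indicator 1) T x)) := by
            rw [← Real.exp_add, Real.exp_le_exp]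
            linarith [hfar x hcase]
        _ ≤ _ := mul_le_mul_of_nonneg_left hprod (Real.exp_pos _).le

end ShiftSystem

/-! ### Invariant limits of empirical measures of orbits -/

/-- Averages along long orbit segments converge, along some ultrafilter, to the integrals with
respect to an invariant regular probability measure. -/
lemma exists_measurePreserving_tendsto_average {X : Type*} [TopologicalSpace X] [CompactSpace X]
    [T2Space X] [MeasurableSpace X] [BorelSpace X] {f : X → X} (hf : Continuous f) {κ : ℕ → Type*}
    [∀ n, Fintype (κ n)] [∀ n, Nonempty (κ n)] (y : ∀ n, κ n → X) :
    ∃ (F : Ultrafilter ℕ) (μ : Measure X), (F : Filter ℕ) ≤ atTop ∧ μ.Regular ∧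
      IsProbabilityMeasure μ ∧ MeasurePreserving f μ μ ∧ ∀ u : C(X, ℝ),
        Tendsto (fun n : ℕ => ((Fintype.card (κ n) : ℝ) * (n + 1))⁻¹ *
          ∑ v, birkhoffSum f u (n + 1) (y n v)) F (𝓝 (∫ x, u x ∂μ)) := by
  obtain ⟨F, μ, hF, hreg, hprob, hlim⟩ := exists_tendsto_average_integral
    (ι := fun n => κ n × Fin (n + 1)) fun n k => f^[k.2] (y n k.1)
  have hlim' : ∀ u : C(X, ℝ), Tendsto (fun n : ℕ => ((Fintype.card (κ n) : ℝ) * (n + 1))⁻¹ *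
      ∑ v, birkhoffSum f u (n + 1) (y n v)) F (𝓝 (∫ x, u x ∂μ)) := by
    intro u
    refine (hlim u).congr fun n => ?_
    rw [Fintype.card_prod, Fintype.card_fin, Fintype.sum_prod_type]
    push_cast
    congr 1
    refine Finset.sum_congr rfl fun v _ => ?_
    exact Fin.sum_univ_eq_sum_range (fun i => u (f^[i] (y n v))) (n + 1)
  refine ⟨F, μ, hF, hreg, hprob, measurePreserving_of_integral_comp_eq hf fun u => ?_, hlim'⟩
  have h0 : Tendsto (fun n : ℕ => 2 * ‖u‖ * ((n : ℝ) + 1)⁻¹) F (𝓝 0) := by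
    have : Tendsto (fun n : ℕ => 2 * ‖u‖ * ((n : ℝ) + 1)⁻¹) atTop (𝓝 (2 * ‖u‖ * 0)) :=
      (tendsto_inv_atTop_zero.comp
        (tendsto_atTop_add_const_right _ 1 tendsto_natCast_atTop_atTop)).const_mul _
    rw [mul_zero] at this
    exact this.mono_left hF
  have hdiff := (hlim' (u.comp ⟨f, hf⟩)).sub (hlim' u)
  refine sub_eq_zero.1 (tendsto_nhds_unique hdiff (squeeze_zero_norm (fun n => ?_) h0))
  have hc : (0 : ℝ) < Fintype.card (κ n) := by exact_mod_cast Fintype.card_pos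
  rw [← mul_sub, ← Finset.sum_sub_distrib, norm_mul, norm_inv, Real.norm_of_nonneg (by positivity)]
  have hle : ‖∑ v, (birkhoffSum f (u.comp ⟨f, hf⟩) (n + 1) (y n v) -
      birkhoffSum f u (n + 1) (y n v))‖ ≤ Fintype.card (κ n) * (2 * ‖u‖) := by
    refine (norm_sum_le_of_le _ (fun v _ => ?_ : ∀ v ∈ Finset.univ, _ ≤ 2 * ‖u‖)).trans (by simp)
    have : birkhoffSum f (u.comp ⟨f, hf⟩) (n + 1) (y n v) =
        birkhoffSum f u (n + 1) (f (y n v)) := by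
      refine Finset.sum_congr rfl fun i _ => ?_
      simp [← iterate_succ_apply', iterate_succ_apply]
    rw [this, birkhoffSum_apply_sub_birkhoffSum, two_mul]
    exact (norm_sub_le _ _).trans (add_le_add (u.norm_coe_le_norm _) (u.norm_coe_le_norm _))
  calc _ ≤ ((Fintype.card (κ n) : ℝ) * (n + 1))⁻¹ * (Fintype.card (κ n) * (2 * ‖u‖)) := by gcongr
    _ = _ := by field_simp

/-- By convexity of the exponential function, a bound for `∑ exp (-S v)` over `m ^ N` indices bounds
the average of `S` from below. -/
lemma mul_log_le_sum_of_sum_exp_neg_le {κ : Type*} [Fintype κ] {m N D : ℕ} (hm : 0 < m)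
    (hκ : Fintype.card κ = m ^ N) {S : κ → ℝ} (hS : ∑ v, Real.exp (-S v) ≤ (m : ℝ) ^ D) :
    (m : ℝ) ^ N * ((N - D) * Real.log m) ≤ ∑ v, S v := by
  have hmR : (0 : ℝ) < m := by exact_mod_cast hm
  set r := ((N : ℝ) - D) * Real.log m with hr
  have hexp : Real.exp (-r) * (m : ℝ) ^ N = (m : ℝ) ^ D := by
    have : ∀ k : ℕ, (m : ℝ) ^ k = Real.exp (k * Real.log m) := fun k => by
      rw [Real.exp_nat_mul, Real.exp_log hmR]
    rw [this, this, ← Real.exp_add]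
    congr 1
    rw [hr]; ring
  have h1 : Real.exp (-r) * ∑ v, (1 + (r - S v)) ≤ Real.exp (-r) * (m : ℝ) ^ N := by
    rw [hexp]
    refine le_trans ?_ hS
    rw [Finset.mul_sum]
    refine Finset.sum_le_sum fun v _ => ?_
    calc _ ≤ Real.exp (-r) * Real.exp (r - S v) := by
          gcongr
          linarith [Real.add_one_le_exp (r - S v)]
      _ = _ := by rw [← Real.exp_add]; congr 1; ring
  have h2 := le_of_mul_le_mul_left h1 (Real.exp_pos _)
  rw [Finset.sum_add_distrib, Finset.sum_sub_distrib] at h2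
  simp only [Finset.sum_const, Finset.card_univ, hκ, nsmul_eq_mul, Nat.cast_pow] at h2
  linarith

/-! ### The entropy bound -/

/-- Outside a neighbourhood `N` of the kernel, the symbol of a point is locally constant, uniformly
so. -/
lemma ShiftSystem.exists_entourage_symbol {X : Type*} [UniformSpace X] [CompactSpace X] {f : X → X}
    {m : ℕ} (hm : 0 < m) {H : ShiftSystem f m} (hH : H.IsClosedSystem) {N : Set X}
    (hN : H.kernel ⊆ interior N) :
    ∃ V ∈ 𝓤 X, ∃ symb : X → Fin m, ∀ x z b, (x, z) ∈ V → x ∈ H.piece b → x ∉ N → b = symb z := by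
  let O : Fin m → Set X := fun a => ⋂ b ∈ (Finset.univ.erase a), (H.piece b \ interior N)ᶜ
  have hO : ∀ a, IsOpen (O a) := fun a => isOpen_biInter_finset fun b _ =>
    ((hH b).sdiff isOpen_interior).isOpen_compl
  have hcov : (Set.univ : Set X) ⊆ ⋃ a, O a := by
    intro x _
    rw [Set.mem_iUnion]
    by_cases h : ∃ a, x ∈ H.piece a \ interior N
    · obtain ⟨a, ha, haN⟩ := h
      refine ⟨a, Set.mem_iInter₂.2 fun b hb hxb => haN (hN ?_)⟩
      exact ⟨a, b, (Finset.ne_of_mem_erase hb).symm, ha, hxb.1⟩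
    · push Not at h
      exact ⟨⟨0, hm⟩, Set.mem_iInter₂.2 fun b _ => h b⟩
  obtain ⟨V, hV, hVO⟩ := lebesgue_number_lemma isCompact_univ hO hcov
  choose symb hsymb using fun z => hVO z (Set.mem_univ z)
  refine ⟨Prod.swap ⁻¹' V, symm_le_uniformity hV, symb, fun x z b hxz hb hxN => ?_⟩
  by_contra hne
  have hx : x ∈ O (symb z) := hsymb z hxz
  exact Set.mem_iInter₂.1 hx b (Finset.mem_erase.2 ⟨hne, Finset.mem_univ b⟩)
    ⟨hb, fun h => hxN (interior_subset h)⟩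

lemma ShiftSystem.isCompact_kernel {X : Type*} [TopologicalSpace X] [CompactSpace X] {f : X → X}
    {m : ℕ} {H : ShiftSystem f m} (hH : H.IsClosedSystem) : IsCompact H.kernel := by
  have : H.kernel = ⋃ k : {k : Fin m × Fin m // k.1 ≠ k.2}, H.piece k.1.1 ∩ H.piece k.1.2 := by
    ext x
    simp only [kernel, Set.mem_ofPred_eq, Set.mem_iUnion, Subtype.exists, Prod.exists, exists_prop]
  rw [this]
  exact (isClosed_iUnion_of_finite fun k => (hH _).inter (hH _)).isCompact

/-- A countable compact set has a closed neighbourhood that has measure less than `2 * δ` off any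
set `P` carrying all atoms up to mass `δ`. -/
lemma exists_isClosed_nhd_measure_diff_lt {X : Type*} [TopologicalSpace X] [CompactSpace X]
    [T2Space X] [MeasurableSpace X] [BorelSpace X] {μ : Measure X} [IsFiniteMeasure μ] [μ.Regular]
    {Q P : Set X} (hQ : IsCompact Q) (hQc : Q.Countable) {δ : ℝ} (hδ : 0 < δ)
    (hP : μ ({x | μ {x} ≠ 0} \ P) < ENNReal.ofReal δ) :
    ∃ E : Set X, IsClosed E ∧ Q ⊆ interior E ∧ μ (E \ P) < ENNReal.ofReal (2 * δ) := by
  have hδ' : ENNReal.ofReal δ ≠ 0 := by simpa using hδ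
  obtain ⟨O, hQO, hO, -, hμO⟩ := hQ.measurableSet.exists_isOpen_sdiff_lt (measure_ne_top μ Q) hδ'
  obtain ⟨E, hE, hQE, hEO⟩ := normal_exists_closure_subset hQ.isClosed hO hQO
  refine ⟨closure E, isClosed_closure, hQE.trans (interior_maximal subset_closure hE), ?_⟩
  have hQ0 : μ (Q ∩ {x | μ {x} = 0}) = 0 :=
    (measure_null_iff_singleton (hQc.mono Set.inter_subset_left)).2 fun x hx => hx.2
  have hsub : closure E \ P ⊆ (O \ Q) ∪ (({x | μ {x} ≠ 0} \ P) ∪ (Q ∩ {x | μ {x} = 0})) := by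
    rintro x ⟨hx, hxP⟩
    by_cases hxQ : x ∈ Q
    · by_cases h0 : μ {x} = 0
      · exact Or.inr (Or.inr ⟨hxQ, h0⟩)
      · exact Or.inr (Or.inl ⟨h0, hxP⟩)
    · exact Or.inl ⟨hEO hx, hxQ⟩
  calc μ (closure E \ P) ≤ μ (O \ Q) + (μ ({x | μ {x} ≠ 0} \ P) + μ (Q ∩ {x | μ {x} = 0})) :=
        (measure_mono hsub).trans ((measure_union_le _ _).trans
          (add_le_add le_rfl (measure_union_le _ _)))
    _ = μ (O \ Q) + μ ({x | μ {x} ≠ 0} \ P) := by rw [hQ0, add_zero]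
    _ < ENNReal.ofReal δ + ENNReal.ofReal δ := ENNReal.add_lt_add hμO hP
    _ = _ := by rw [← ENNReal.ofReal_add hδ.le hδ.le, two_mul]

theorem theorem2 {X : Type*} [UniformSpace X] [CompactSpace X] [T2Space X]
    {f : X → X} (hf : Continuous f) {m : ℕ} (hm : 1 ≤ m)
    (H : ShiftSystem f m) (hclosed : H.IsClosedSystem) (hnontriv : H.IsNontrivial)
    (hker : H.KernelEventuallyCountable)
    (hW : ∃ W : Set X, (∀ M : Set X, IsMinimalSet f M → M ⊆ H.core → M ⊆ W) ∧
      LocallyDivides W H) :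
    ((Real.log m : ℝ) : EReal) ≤ Dynamics.coverEntropy f Set.univ := by
  classical
  obtain ⟨W, hWmin, hWdiv⟩ := hW
  obtain ⟨y, hy, hyW⟩ := hWdiv.not_subset ⟨0, hm⟩
  have hnonneg : 0 ≤ coverEntropy f (Set.univ : Set X) := coverEntropy_nonneg f ⟨y, trivial⟩
  rcases hm.eq_or_lt with rfl | hm2
  · simpa using hnonneg
  have hm2 : 2 ≤ m := hm2
  by_contra! hlt
  obtain ⟨a, ha, ham⟩ := EReal.lt_iff_exists_real_btwn.1 hlt
  have ha0 : 0 < a := by exact_mod_cast hnonneg.trans_lt ha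
  have ham : a < Real.log m := by exact_mod_cast ham
  -- the points following all words, and a limit of their empirical measures
  choose pt hpt using H.exists_follows hWdiv.image_subset (Set.mem_iUnion.2 ⟨_, hy⟩) hyW
  have : Nonempty (Fin m) := ⟨⟨0, hm⟩⟩
  let _ : MeasurableSpace X := borel X
  have : BorelSpace X := ⟨rfl⟩
  obtain ⟨F, μ, hF, hreg, hprob, hinv, hlim⟩ := exists_measurePreserving_tendsto_average hf
    (κ := fun n => Fin (n + 1) → Fin m) fun n v => pt (List.ofFn v)
  -- a function `φ` that pays for a code of all words has integral at least `log m`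
  have hint : ∀ (φ : C(X, ℝ)) (D : ℕ),
      (∀ (n : ℕ) (S : Finset (List (Fin m))), (∀ l ∈ S, l.length = n) →
        ∑ l ∈ S, Real.exp (-birkhoffSum f φ n (pt l)) ≤ (m : ℝ) ^ D) →
      Real.log m ≤ ∫ x, φ x ∂μ := by
    intro φ D hφ
    have h0 : Tendsto (fun n : ℕ => Real.log m - D * Real.log m * ((n : ℝ) + 1)⁻¹) F
        (𝓝 (Real.log m)) := by
      have : Tendsto (fun n : ℕ => Real.log m - D * Real.log m * ((n : ℝ) + 1)⁻¹) atTop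
          (𝓝 (Real.log m - D * Real.log m * 0)) :=
        ((tendsto_inv_atTop_zero.comp
          (tendsto_atTop_add_const_right _ 1 tendsto_natCast_atTop_atTop)).const_mul _).const_sub _
      rw [mul_zero, sub_zero] at this
      exact this.mono_left hF
    refine le_of_tendsto_of_tendsto' h0 (hlim φ) fun n => ?_
    have hS : ∑ v : Fin (n + 1) → Fin m,
        Real.exp (-birkhoffSum f φ (n + 1) (pt (List.ofFn v))) ≤ (m : ℝ) ^ D := by
      have := hφ (n + 1) (Finset.univ.image fun v : Fin (n + 1) → Fin m => List.ofFn v) (by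
        intro l hl
        obtain ⟨v, -, rfl⟩ := Finset.mem_image.1 hl
        simp)
      rwa [Finset.sum_image fun v _ v' _ h => List.ofFn_injective h] at this
    have := mul_log_le_sum_of_sum_exp_neg_le (N := n + 1) (by omega) (by simp) hS
    have hmR : (0 : ℝ) < (m : ℝ) ^ (n + 1) := by positivity
    simp only [Fintype.card_fun, Fintype.card_fin, Nat.cast_pow]
    rw [inv_mul_eq_div, le_div_iff₀ (by positivity)]
    refine le_trans (le_of_eq ?_) this
    push_cast
    field_simp
  set A : Set X := {x | μ {x} ≠ 0} with hA
  have hAper : ∀ x ∈ A, x ∈ periodicPts f := fun x hx =>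
    mem_periodicPts_of_measure_singleton_ne_zero hinv hx
  -- `P₁` carries all but mass `1 / 2` of the atoms; every block of the code that is not a block
  -- near `P₀ \ P₁` gains `g` per symbol over `log m`
  obtain ⟨P₁, hP₁fin, hP₁A, hP₁f, hμP₁⟩ := exists_finite_mapsTo_measure_atoms_diff_lt hinv
    (δ := ENNReal.ofReal (1 / 2)) (by simp)
  have hwords : ∀ p ∈ P₁, ∃ c < Real.log m, ∀ᶠ R : ℕ in atTop,
      ∃ (G : Set X) (B : Finset (List (Fin m))), IsOpen G ∧ p ∈ G ∧ (∀ l ∈ B, l.length = R) ∧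
        (B.card : ℝ) ≤ Real.exp (c * R) ∧
        ∀ x ∈ G, ∀ l, l.length = R → H.Follows W x l → l ∈ B := by
    intro p hp
    by_cases hpc : p ∈ H.core
    · exact ShiftSystem.exists_words_of_mem_core hf hWdiv hWmin (hAper p (hP₁A hp)) hpc
    · exact H.exists_words_of_notMem_core hf hm2 hclosed (hAper p (hP₁A hp)) hpc W
  choose! c hc hcB using hwords
  obtain ⟨g, ⟨hga, hgc⟩, hg⟩ : ∃ g, (a ≤ Real.log m - g ∧ ∀ p ∈ P₁, c p ≤ Real.log m - g) ∧
      0 < g := by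
    have h1 : ∀ b < Real.log m, ∀ᶠ g in 𝓝[>] (0 : ℝ), b ≤ Real.log m - g := by
      intro b hb
      filter_upwards [nhdsWithin_le_nhds (Iic_mem_nhds (sub_pos.2 hb))] with g hg
      have : g ≤ Real.log m - b := hg
      linarith
    exact (((h1 a ham).and ((Set.Finite.eventually_all hP₁fin).2 fun p hp =>
      h1 _ (hc p hp))).and self_mem_nhdsWithin).exists
  set η := g / 8 with hη
  -- beyond the cover, a symbol that the cover predicts costs `η / 2`, any other one costs `K`
  obtain ⟨K, hκK, hK⟩ : ∃ K, Real.exp (-(η / 2)) + m * Real.exp (-K) ≤ 1 ∧ 0 < K := by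
    have h1 : Tendsto (fun K => Real.exp (-(η / 2)) + m * Real.exp (-K)) atTop
        (𝓝 (Real.exp (-(η / 2)) + m * 0)) :=
      (Real.tendsto_exp_neg_atTop_nhds_zero.const_mul _).const_add _
    have h2 : Real.exp (-(η / 2)) + m * 0 < 1 := by
      rw [mul_zero, add_zero, Real.exp_lt_one_iff]
      linarith
    exact ((h1.eventually_le_const h2).and (eventually_gt_atTop 0)).exists
  set δ := g / (16 * K) with hδ
  have hδ0 : 0 < δ := by positivity
  obtain ⟨P₀, hP₀fin, hP₀A, hP₀f, hμP₀⟩ := exists_finite_mapsTo_measure_atoms_diff_lt hinv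
    (δ := ENNReal.ofReal δ) (by simpa using hδ0)
  -- the symbols are determined outside `f^[j] ⁻¹' E`
  obtain ⟨j, hj⟩ := hker
  obtain ⟨E, hE, hQE, hμE⟩ := exists_isClosed_nhd_measure_diff_lt
    ((ShiftSystem.isCompact_kernel hclosed).image (hf.iterate j)) hj hδ0 hμP₀
  obtain ⟨V, hV, symb, hsymb⟩ := ShiftSystem.exists_entourage_symbol (by omega) hclosed
    (N := f^[j] ⁻¹' E) (by
      refine fun x hx => preimage_interior_subset_interior_preimage (hf.iterate j) ?_
      exact hQE ⟨x, hx, rfl⟩)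
  obtain ⟨T, ⟨s, hscov, hscard⟩, hTη, hT0⟩ : ∃ T : ℕ,
      (∃ s : Finset X, IsDynCoverOf f Set.univ V T s ∧ (s.card : ℝ) ≤ Real.exp (a * T)) ∧
      2 * (Real.log 2 + K * j) / η ≤ T ∧ 0 < T :=
    ((eventually_exists_isDynCoverOf_card_le ha hV).and
      ((tendsto_natCast_atTop_atTop.eventually_ge_atTop _).and (eventually_gt_atTop 0))).exists
  -- the gain is lost in a neighbourhood of `P₀ \ P₁` only
  obtain ⟨u, Y, hu0, hY, hPY, huY, hintu⟩ := exists_continuousMap_one_le_of_measure_lt (μ := μ)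
    (hP₀fin.sdiff (t := P₁)).isClosed (r := 1 / 2)
    ((measure_mono (Set.sdiff_subset_sdiff_left hP₀A)).trans_lt hμP₁)
  obtain ⟨R, hRc, hRη, hR0⟩ : ∃ R : ℕ, (∀ p ∈ P₁, ∃ (G : Set X) (B : Finset (List (Fin m))),
      IsOpen G ∧ p ∈ G ∧ (∀ l ∈ B, l.length = R) ∧ (B.card : ℝ) ≤ Real.exp (c p * R) ∧
        ∀ x ∈ G, ∀ l, l.length = R → H.Follows W x l → l ∈ B) ∧
      (Real.log (2 * T * hP₀fin.toFinset.card) + g * T) / η ≤ R ∧ 0 < R :=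
    (((Set.Finite.eventually_all hP₁fin).2 hcB).and
      ((tendsto_natCast_atTop_atTop.eventually_ge_atTop _).and (eventually_gt_atTop 0))).exists
  have hblocks : ∀ p ∈ P₀, ∃ (G : Set X) (B : Finset (List (Fin m))) (r : ℝ), IsOpen G ∧ p ∈ G ∧
      (∀ l ∈ B, l.length = R) ∧ (B.card : ℝ) ≤ Real.exp (r * R) ∧
      (∀ x ∈ G, ∀ l, l.length = R → H.Follows W x l → l ∈ B) ∧
      (r ≤ Real.log m - g ∨ r = Real.log m ∧ ∀ x ∈ G, ∀ i < R, f^[i] x ∈ Y) := by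
    intro p hp
    by_cases hp₁ : p ∈ P₁
    · obtain ⟨G, B, h1, h2, h3, h4, h5⟩ := hRc p hp₁
      exact ⟨G, B, c p, h1, h2, h3, h4, h5, Or.inl (hgc p hp₁)⟩
    · -- the orbit of `p` does not meet `P₁`, which is invariant and consists of periodic points
      have horb : ∀ i, f^[i] p ∈ Y := by
        refine fun i => hPY ⟨hP₀f.iterate i hp, fun hi => hp₁ ?_⟩
        have hper := hAper p (hP₀A hp)
        have h := hP₁f.iterate (minimalPeriod f p * i - i) hi
        rwa [← iterate_add_apply, Nat.sub_add_cancel (Nat.le_mul_of_pos_left i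
          (minimalPeriod_pos_of_mem_periodicPts hper)),
          ((isPeriodicPt_minimalPeriod f p).mul_const i).eq] at h
      refine ⟨⋂ i ∈ Finset.range R, f^[i] ⁻¹' Y,
        Finset.univ.image fun v : Fin R → Fin m => List.ofFn v, Real.log m,
        isOpen_biInter_finset fun i _ => hY.preimage (hf.iterate i), ?_, ?_, ?_, ?_,
        Or.inr ⟨rfl, ?_⟩⟩
      · simp only [Set.mem_iInter]
        exact fun i _ => horb i
      · intro l hl
        obtain ⟨v, -, rfl⟩ := Finset.mem_image.1 hl
        simp
      · rw [mul_comm, Real.exp_nat_mul, Real.exp_log (by positivity)]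
        refine (Nat.cast_le.2 Finset.card_image_le).trans ?_
        simp
      · rintro x - l rfl -
        exact Finset.mem_image.2 ⟨l.get, Finset.mem_univ _, List.ofFn_get l⟩
      · intro x hx i hi
        simp only [Set.mem_iInter, Finset.mem_range] at hx
        exact hx i hi
  choose! G B r hG hpG hBlen hBcard hBmem hr using hblocks
  -- visits to `E` far from `P₀`, where symbols are undetermined, have frequency less than `2 * δ`
  obtain ⟨v, O, hv0, -, hEO, hvO, hintv⟩ := exists_continuousMap_one_le_of_measure_lt (μ := μ)
    (C := E \ ⋃ p ∈ P₀, G p) (hE.sdiff (isOpen_biUnion hG)) (r := 2 * δ)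
    ((measure_mono (Set.sdiff_subset_sdiff_right fun p hp => Set.mem_biUnion hp (hpG p hp))).trans_lt
      hμE)
  let φ : C(X, ℝ) := ContinuousMap.const X (Real.log m - g + η) + g • u +
    K • v.comp ⟨f^[j], hf.iterate j⟩
  have hφ : ∀ x, φ x = Real.log m - g + η + g * u x + K * v (f^[j] x) := fun x => by simp [φ]
  have hφsum : ∀ n x, birkhoffSum f φ n x = n * (Real.log m - g + η) + g * birkhoffSum f u n x +
      K * ∑ i ∈ Finset.range n, v (f^[j] (f^[i] x)) := by
    intro n x
    simp only [birkhoffSum, hφ, Finset.sum_add_distrib, Finset.mul_sum, Finset.sum_const,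
      Finset.card_range, nsmul_eq_mul, mul_add]
  have hu_sum : ∀ n x, 0 ≤ birkhoffSum f u n x := fun n x => Finset.sum_nonneg fun i _ => hu0 _
  have hv_sum : ∀ n x, 0 ≤ ∑ i ∈ Finset.range n, v (f^[j] (f^[i] x)) := fun n x =>
    Finset.sum_nonneg fun i _ => hv0 _
  have hη0 : 0 < η := by positivity
  have hφint : ∫ x, φ x ∂μ < Real.log m := by
    have hi : ∀ w : C(X, ℝ), Integrable (fun x => w x) μ := fun w =>
      w.continuous.integrable_of_hasCompactSupport (HasCompactSupport.of_compactSpace _)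
    have hvj : ∫ x, v (f^[j] x) ∂μ = ∫ x, v x ∂μ := by
      have hj := hinv.iterate j
      conv_rhs => rw [← hj.map_eq]
      exact (integral_map hj.measurable.aemeasurable v.continuous.aestronglyMeasurable).symm
    simp only [hφ]
    have hiu : Integrable (fun x => g * u x) μ := (hi u).const_mul g
    have hiv : Integrable (fun x => K * v (f^[j] x)) μ :=
      (hi (v.comp ⟨f^[j], hf.iterate j⟩)).const_mul K
    rw [integral_add (f := fun x => Real.log m - g + η + g * u x)
      ((integrable_const _).add hiu) hiv, integral_add (integrable_const _) hiu,
      integral_const_mul, integral_const_mul, hvj]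
    simp only [integral_const, probReal_univ, smul_eq_mul, one_mul]
    have h1 : K * ∫ x, v x ∂μ < K * (2 * δ) := mul_lt_mul_of_pos_left hintv hK
    have h2 : K * (2 * δ) = g / 8 := by rw [hδ]; field_simp; ring
    have h3 : g * ∫ x, u x ∂μ < g * (1 / 2) := mul_lt_mul_of_pos_left hintu hg
    linarith
  refine absurd (hint φ (T + R) fun n S hS => ?_) (not_le.2 hφint)
  refine H.sum_exp_neg_birkhoffSum_le_of_blocks (by omega) (W := W) (φ := φ) ?_ hT0 hR0 hP₀fin.toFinset G B r
    (by simpa using hBlen) (by simpa using hBcard) (by simpa using hBmem) s hscard symb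
    (f^[j] ⁻¹' E) ?_ hκK (by positivity) hK.le ?_ ?_ n S hS pt fun l _ => hpt l
  · intro x
    rw [hφ]
    have := mul_nonneg hg.le (hu0 x)
    have := mul_nonneg hK.le (hv0 (f^[j] x))
    linarith
  · intro x
    obtain ⟨z, hz, hxz⟩ := hscov (Set.mem_univ x)
    exact ⟨z, hz, fun i hi b hb hN => hsymb _ _ b (mem_dynEntourage.1 hxz i hi) hb hN⟩
  · intro x hx
    simp only [Set.Finite.mem_toFinset] at hx
    -- a visit of `f^[i + j] x` to `E` is paid for by `v` unless `T ≤ i + j`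
    have hN : birkhoffSum f ((f^[j] ⁻¹' E).indicator 1) T x ≤
        ∑ i ∈ Finset.range T, v (f^[j] (f^[i] x)) + j := by
      have h1 : ∀ i ∈ Finset.range T, (f^[j] ⁻¹' E).indicator (1 : X → ℝ) (f^[i] x) ≤
          v (f^[j] (f^[i] x)) + if T ≤ i + j then 1 else 0 := by
        intro i hi
        by_cases hiE : f^[i] x ∈ f^[j] ⁻¹' E
        · rw [Set.indicator_of_mem hiE, Pi.one_apply]
          split_ifs with hij
          · linarith [hv0 (f^[j] (f^[i] x))]
          · rw [add_zero]
            refine hvO _ (hEO ⟨hiE, fun h => ?_⟩)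
            obtain ⟨p, hp, hxp⟩ := Set.mem_iUnion₂.1 h
            rw [← iterate_add_apply] at hxp
            exact hx (j + i) (by omega) p hp hxp
        · rw [Set.indicator_of_notMem hiE]
          have := hv0 (f^[j] (f^[i] x))
          split_ifs <;> linarith
      refine (Finset.sum_le_sum h1).trans ?_
      rw [Finset.sum_add_distrib]
      refine add_le_add le_rfl ?_
      rw [Finset.sum_boole]
      have : ({i ∈ Finset.range T | T ≤ i + j} : Finset ℕ) ⊆ Finset.Ico (T - j) T := by
        intro i hi
        simp only [Finset.mem_filter, Finset.mem_range] at hi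
        rw [Finset.mem_Ico]
        omega
      have := Finset.card_le_card this
      rw [Nat.card_Ico] at this
      exact_mod_cast this.trans (by omega)
    rw [hφsum]
    rw [div_le_iff₀ hη0] at hTη
    have h1 := mul_le_mul_of_nonneg_left hN hK.le
    have h2 := mul_nonneg hg.le (hu_sum T x)
    have h3 : a * T ≤ (Real.log m - g) * T := by gcongr
    linarith
  · intro x t ht p hp hxp
    have hp : p ∈ P₀ := by simpa using hp
    rw [hφsum]
    rw [div_le_iff₀ hη0] at hRη
    have h1 := mul_nonneg hK.le (hv_sum (t + R) x)
    have h2 : g * t ≤ g * T := by gcongr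
    have h3 : 0 ≤ η * t := by positivity
    push_cast
    rcases hr p hp with hrp | ⟨hrp, hGY⟩
    · have h4 := mul_nonneg hg.le (hu_sum (t + R) x)
      have h5 : r p * R ≤ (Real.log m - g) * R := by gcongr
      linarith
    · have h4 : (R : ℝ) ≤ birkhoffSum f u (t + R) x := by
        rw [birkhoffSum_add]
        have h5 : (R : ℝ) ≤ birkhoffSum f u R (f^[t] x) := by
          calc (R : ℝ) = ∑ _i ∈ Finset.range R, (1 : ℝ) := by simp
            _ ≤ _ := Finset.sum_le_sum fun i hi =>
              huY _ (hGY _ hxp i (Finset.mem_range.1 hi))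
        linarith [hu_sum t x]
      have h6 := mul_le_mul_of_nonneg_left h4 hg.le
      rw [hrp]
      linarith
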